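/- Let $E$ be a real normed space with its Borel $\sigma$-algebra and a measure $\mathrm{vol}$ such that, for an integer $d\ge 1$ and a constant $c>0$, $\mathrm{vol}\{x:\|x\|\le r\}=c\,r^d$ for all $r>0$ (for instance Lebesgue measure on $\mathbb{R}^d$ with any norm). Let $a>0$, $\kappa\ge 1$, let $N\ge 1$ be an integer, and let $a=\rho_0>\rho_1>\dots>\rho_m=a/\kappa$ be any grid of $[a/\kappa,a]$. Put $B_\ell=\{x:\|x\|\le\rho_\ell\}$ and let $X_{\ell,i}$ ($0\le\ell\le m$, $1\le i\le N$) be mutually independent random vectors, $X_{\ell,i}$ being uniformly distributed on $B_\ell$. Apply the sample reuse method: $Y_{0,i}=X_{0,i}$ for all $i$; for $\ell\ge1$ let $\mathbf{k}_\ell$ be the number of indices $i$ with $Y_{\ell-1,i}\in B_\ell$, let $Y_{\ell,1},\dots,Y_{\ell,\mathbf{k}_\ell}$ be those $Y_{\ell-1,i}$ in increasing order of $i$, and let $Y_{\ell,i}=X_{\ell,i}$ for $\mathbf{k}_\ell<i\le N$. The original samples are the samples actually generated, namely the $X_{0,i}$ with $1\le i\le N$ and the $X_{\ell,i}$ with $1\le\ell\le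 m$ and $\mathbf{k}_\ell<i\le N$. Let $\boldsymbol{N}_\rho$ be the number of original samples (over all levels) lying in $\{x:\|x\|\le\rho\}$; it is integrable for every $\rho$. The density of original samples at radius $\rho$ is $$\mathcal{D}(\rho)=\lim_{\delta\to0}\frac{\mathbb{E}[\boldsymbol{N}_{\rho+\delta}-\boldsymbol{N}_\rho]}{\delta},$$ where the limit is two-sided if $\rho$ is not one of the grid points $\rho_0,\dots,\rho_m$, is taken from the left ($\delta\uparrow0$) at $\rho=\rho_m=a/\kappa$, and is taken from the right ($\delta\downarrow0$) at the other grid points. Then $\mathcal{D}(\rho)$ exists for every $\rho\in(0,a]$, and $$\mathcal{D}(\rho)=\frac{Nd}{\rho}\left(\frac{\kappa\rho}{a}\right)^d\quad\text{for }\rho\in\left(0,\tfrac a\kappa\right],\qquad \mathcal{D}(\rho)<\frac{Nd}{\rho}\quad\text{for }\rho\in\left(\tfrac a\kappa,a\right].$$ -/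

import Mathlib

namespace SampleReuse

open MeasureTheory Filter Topology

/-- Indices `i` for which the sample `x i` falls into the set `B`. Its cardinality is the
reusable sample size `k`. -/
noncomputable def reusable {E : Type*} {n : ℕ} (B : Set E) (x : Fin n → E) : Finset (Fin n) :=
  open Classical in Finset.univ.filter fun i => x i ∈ B

/-- The sample reuse function `(x₁, …, xₙ; y₁, …, yₙ) ↦ (z₁, …, zₙ)` for the set `B`: the samples
`x i` that fall into `B` come first, in increasing order of their indices, and the remaining
positions `l` are filled with `y l`. -/
noncomputable def reuse {E : Type*} {n : ℕ} (B : Set E) (x y : Fin n → E) : Fin n → E :=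
  fun l => if h : (l : ℕ) < (reusable B x).card
    then x ((reusable B x).orderEmbOfFin rfl ⟨l, h⟩)
    else y l

/-- The samples `y_{ℓ,1}, …, y_{ℓ,N}` used by the sample reuse method for the ball of radius
`g ℓ`, where `x ℓ i` are the samples available for that ball. -/
noncomputable def pool {E : Type*} [NormedAddCommGroup E] {N : ℕ} (g : ℕ → ℝ)
    (x : ℕ → Fin N → E) : ℕ → Fin N → E
  | 0 => x 0
  | ℓ + 1 => reuse (Metric.closedBall 0 (g (ℓ + 1))) (pool g x ℓ) (x (ℓ + 1))

/-- The number of samples reused for the ball of radius `g ℓ`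
(none for the first, largest ball). -/
noncomputable def reusedCount {E : Type*} [NormedAddCommGroup E] {N : ℕ} (g : ℕ → ℝ)
    (x : ℕ → Fin N → E) : ℕ → ℕ
  | 0 => 0
  | ℓ + 1 => (reusable (Metric.closedBall 0 (g (ℓ + 1))) (pool g x ℓ)).card

/-- The number of original samples in the ball of radius `ρ` when the sample reuse method is run
over the balls of radii `g 0, …, g m`. A sample `x ℓ i` is original (it really has to be
generated) if the position `i` at level `ℓ` is not filled by a reused sample. -/
noncomputable def originalCount {E : Type*} [NormedAddCommGroup E] {N : ℕ} (g : ℕ → ℝ) (m : ℕ)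
    (x : ℕ → Fin N → E) (ρ : ℝ) : ℕ :=
  open Classical in
  ∑ ℓ ∈ Finset.range (m + 1),
    (Finset.univ.filter fun i : Fin N =>
      reusedCount g x ℓ ≤ (i : ℕ) ∧ x ℓ i ∈ Metric.closedBall (0 : E) ρ).card

/-- The quotient `𝔼[N_{ρ+δ} - N_ρ] / δ`, whose limit for `δ → 0` is the density of original
samples at radius `ρ`. -/
noncomputable def densityQuotient {Ω E : Type*} [MeasurableSpace Ω] [NormedAddCommGroup E] {N : ℕ}
    (P : Measure Ω) (g : ℕ → ℝ) (m : ℕ) (X : ℕ → Fin N → Ω → E) (ρ δ : ℝ) : ℝ :=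
  (∫ ω, ((originalCount g m (fun ℓ i => X ℓ i ω) (ρ + δ) : ℝ)
    - (originalCount g m (fun ℓ i => X ℓ i ω) ρ : ℝ)) ∂P) / δ

end SampleReuse

open MeasureTheory ProbabilityTheory Filter Topology

/-! Reuse neither loses nor duplicates samples: for `ρ ≤ g j`, each original sample of levels `≤ j`
lying in the ball of radius `ρ` survives in the pool of level `j` (`card_reusable_reuse`,
`integral_card_reusable_pool_eq_sum`). The reused count at a level depends only on earlier levels,
hence is independent of each new sample, and induction shows that the pool behaves in mean like `N`
uniform samples: its expected number of points in that ball is `N (ρ / g j) ^ d`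
(`integral_card_reusable_pool`).

If also `g (j + 1) ≤ ρ`, samples generated at levels beyond `j` are almost surely in the ball and
contribute a constant. So the expected count is `N (ρ / g j) ^ d + C` on each grid interval, with
derivative `N d / ρ * (ρ / g j) ^ d`. For `j = m` this is the exact formula; above `a / κ`, right
limits allow `ρ < g j`, so the last factor is below one. From `a` on, the expected count is
constant. -/

namespace SampleReuse

/-! ### Combinatorics of a single reuse step -/

section Deterministic

variable {E : Type*} {n : ℕ}

theorem mem_reusable {B : Set E} {x : Fin n → E} {i : Fin n} : i ∈ reusable B x ↔ x i ∈ B := by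
  classical
  simp [reusable]

/-- The positions `i ≥ k` whose sample lies in `A`. -/
noncomputable def freshHits (k : ℕ) (A : Set E) (y : Fin n → E) : Finset (Fin n) :=
  open Classical in Finset.univ.filter fun i => k ≤ (i : ℕ) ∧ y i ∈ A

theorem mem_freshHits {k : ℕ} {A : Set E} {y : Fin n → E} {i : Fin n} :
    i ∈ freshHits k A y ↔ k ≤ (i : ℕ) ∧ y i ∈ A := by
  classical
  simp [freshHits]

theorem freshHits_zero (A : Set E) (y : Fin n → E) : freshHits 0 A y = reusable A y := by
  ext i
  simp [mem_freshHits, mem_reusable]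

theorem card_reusable_le (B : Set E) (x : Fin n → E) : (reusable B x).card ≤ n := by
  simpa using Finset.card_le_univ (reusable B x)

theorem reuse_of_lt {B : Set E} {x y : Fin n → E} {l : Fin n}
    (h : (l : ℕ) < (reusable B x).card) :
    reuse B x y l = x ((reusable B x).orderEmbOfFin rfl ⟨l, h⟩) := by
  simp [reuse, h]

theorem reuse_of_le {B : Set E} {x y : Fin n → E} {l : Fin n}
    (h : (reusable B x).card ≤ (l : ℕ)) : reuse B x y l = y l := by
  simp [reuse, h.not_gt]

/-- Positions below `k` enumerate bijectively the `x i` in `B`, which include all those in `A`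
because `A ⊆ B`; the remaining positions carry `y`. -/
theorem card_reusable_reuse {A B : Set E} (hAB : A ⊆ B) (x y : Fin n → E) :
    (reusable A (reuse B x y)).card
      = (reusable A x).card + (freshHits (reusable B x).card A y).card := by
  classical
  set k := (reusable B x).card with hk
  rw [← Finset.card_filter_add_card_filter_not (s := reusable A (reuse B x y))
    (fun l : Fin n => (l : ℕ) < k)]
  congr 1
  · refine Finset.card_bij
      (fun l hl => (reusable B x).orderEmbOfFin rfl ⟨l, (Finset.mem_filter.1 hl).2⟩) ?_ ?_ ?_
    · intro l hl
      have h := Finset.mem_filter.1 hl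
      have h1 := mem_reusable.1 h.1
      rw [reuse_of_lt h.2] at h1
      exact mem_reusable.2 h1
    · intro l hl l' hl' h
      have := ((reusable B x).orderEmbOfFin rfl).injective h
      simpa [Fin.ext_iff] using this
    · intro i hi
      have hiA := mem_reusable.1 hi
      have hiB : i ∈ Set.range ((reusable B x).orderEmbOfFin rfl) := by
        rw [Finset.range_orderEmbOfFin]
        exact mem_reusable.2 (hAB hiA)
      obtain ⟨j, hj⟩ := hiB
      have hlt : (j : ℕ) < n := j.2.trans_le (card_reusable_le B x)
      refine ⟨⟨j, hlt⟩, ?_, hj⟩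
      refine Finset.mem_filter.2 ⟨mem_reusable.2 ?_, j.2⟩
      rw [reuse_of_lt (l := ⟨j, hlt⟩) j.2]
      exact hj ▸ hiA
  · congr 1
    ext l
    simp only [Finset.mem_filter, mem_reusable, mem_freshHits, not_lt]
    constructor
    · rintro ⟨h1, h2⟩
      exact ⟨h2, by rwa [reuse_of_le h2] at h1⟩
    · rintro ⟨h1, h2⟩
      exact ⟨by rwa [reuse_of_le h1], h1⟩

theorem card_freshHits_eq_sum {Ω : Type*} (k : Ω → ℕ) (A : Set E) (y : Fin n → Ω → E) (ω : Ω) :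
    ((freshHits (k ω) A (fun i => y i ω)).card : ℝ)
      = ∑ i : Fin n, (k ⁻¹' Set.Iic (i : ℕ) ∩ y i ⁻¹' A).indicator (fun _ => (1 : ℝ)) ω := by
  classical
  simp only [freshHits, Finset.card_filter, Nat.cast_sum, Set.indicator_apply]
  refine Finset.sum_congr rfl fun i _ => ?_
  simp

theorem sum_ite_le_eq_sub {k : ℕ} (hk : k ≤ n) :
    ∑ i : Fin n, (if k ≤ (i : ℕ) then (1 : ℝ) else 0) = n - k := by
  rw [Fin.sum_univ_eq_sum_range (fun i => if k ≤ i then (1 : ℝ) else 0), ← Finset.sum_filter]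
  have : (Finset.range n).filter (fun i => k ≤ i) = Finset.Ico k n := by
    ext i; simp; omega
  rw [this]
  simp [Nat.cast_sub hk]

variable [NormedAddCommGroup E]

theorem pool_congr (g : ℕ → ℝ) {x x' : ℕ → Fin n → E} (ℓ : ℕ) (h : ∀ j ≤ ℓ, x j = x' j) :
    pool g x ℓ = pool g x' ℓ := by
  induction ℓ with
  | zero => exact h 0 le_rfl
  | succ ℓ ih =>
    simp only [pool]
    rw [ih fun j hj => h j (hj.trans ℓ.le_succ), h _ le_rfl]

/-- The strict inequality `j < ℓ` is the source of the independence between the reused count and the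
samples of level `ℓ`. -/
theorem reusedCount_congr (g : ℕ → ℝ) {x x' : ℕ → Fin n → E} (ℓ : ℕ)
    (h : ∀ j < ℓ, x j = x' j) : reusedCount g x ℓ = reusedCount g x' ℓ := by
  cases ℓ with
  | zero => rfl
  | succ ℓ =>
    simp only [reusedCount]
    rw [pool_congr g ℓ fun j hj => h j (Nat.lt_succ_of_le hj)]

theorem reusedCount_le (g : ℕ → ℝ) (x : ℕ → Fin n → E) (ℓ : ℕ) : reusedCount g x ℓ ≤ n := by
  cases ℓ with
  | zero => exact Nat.zero_le _
  | succ ℓ => exact card_reusable_le _ _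

theorem originalCount_eq_sum (g : ℕ → ℝ) (m : ℕ) (x : ℕ → Fin n → E) (ρ : ℝ) :
    originalCount g m x ρ = ∑ ℓ ∈ Finset.range (m + 1),
      (freshHits (reusedCount g x ℓ) (Metric.closedBall 0 ρ) (x ℓ)).card := rfl

theorem card_reusable_pool_zero (g : ℕ → ℝ) (x : ℕ → Fin n → E) (A : Set E) :
    (reusable A (pool g x 0)).card = (freshHits (reusedCount g x 0) A (x 0)).card := by
  simp only [reusedCount, freshHits_zero, pool]

theorem card_reusable_pool_succ (g : ℕ → ℝ) (x : ℕ → Fin n → E) (ℓ : ℕ) {A : Set E}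
    (hA : A ⊆ Metric.closedBall 0 (g (ℓ + 1))) :
    (reusable A (pool g x (ℓ + 1))).card = (reusable A (pool g x ℓ)).card
      + (freshHits (reusedCount g x (ℓ + 1)) A (x (ℓ + 1))).card :=
  card_reusable_reuse hA _ _

end Deterministic

/-! ### Measurability, independence and the mean number of fresh hits -/

section Measurability

variable {Ω E : Type*} [MeasurableSpace Ω] [MeasurableSpace E] {n : ℕ}

theorem measurableSet_reusable_eq {B : Set E} (hB : MeasurableSet B) {x : Fin n → Ω → E}
    (hx : ∀ i, Measurable (x i)) (S : Finset (Fin n)) :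
    MeasurableSet {ω | reusable B (fun i => x i ω) = S} := by
  have : {ω | reusable B (fun i => x i ω) = S} = ⋂ i, {ω | x i ω ∈ B ↔ i ∈ S} := by
    ext ω
    simp [Finset.ext_iff, mem_reusable]
  rw [this]
  exact MeasurableSet.iInter fun i => (hx i hB).iff (MeasurableSet.const _)

theorem measurable_card_reusable {B : Set E} (hB : MeasurableSet B) {x : Fin n → Ω → E}
    (hx : ∀ i, Measurable (x i)) : Measurable fun ω => (reusable B (fun i => x i ω)).card := by
  intro t _
  have : (fun ω => (reusable B (fun i => x i ω)).card) ⁻¹' t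
      = ⋃ S ∈ {S : Finset (Fin n) | S.card ∈ t}, {ω | reusable B (fun i => x i ω) = S} := by
    ext ω
    simp
  rw [this]
  exact MeasurableSet.biUnion (Set.to_countable _) fun S _ => measurableSet_reusable_eq hB hx S

/-- The index set of reused samples takes finitely many values `S`; where it equals `S`, the output
is one fixed coordinate of `x` or `y`. -/
theorem measurable_reuse {B : Set E} (hB : MeasurableSet B) {x y : Fin n → Ω → E}
    (hx : ∀ i, Measurable (x i)) (hy : ∀ i, Measurable (y i)) (l : Fin n) :
    Measurable fun ω => reuse B (fun i => x i ω) (fun i => y i ω) l := by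
  intro t ht
  have : (fun ω => reuse B (fun i => x i ω) (fun i => y i ω) l) ⁻¹' t
      = ⋃ S : Finset (Fin n), {ω | reusable B (fun i => x i ω) = S} ∩
        (if h : (l : ℕ) < S.card then x (S.orderEmbOfFin rfl ⟨l, h⟩) else y l) ⁻¹' t := by
    ext ω
    simp only [Set.mem_preimage, Set.mem_iUnion, Set.mem_inter_iff, Set.mem_ofPred_eq,
      exists_eq_left', reuse]
    split_ifs <;> rfl
  rw [this]
  refine MeasurableSet.iUnion fun S => (measurableSet_reusable_eq hB hx S).inter ?_
  split_ifs
  · exact hx _ ht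
  · exact hy _ ht

theorem integrable_natCast_of_le {P : Measure Ω} [IsFiniteMeasure P] {f : Ω → ℕ}
    (hf : Measurable f) {n : ℕ} (h : ∀ ω, f ω ≤ n) : Integrable (fun ω => (f ω : ℝ)) P := by
  refine Integrable.of_bound (C := n) (measurable_from_nat.comp hf).aestronglyMeasurable ?_
  filter_upwards with ω
  simpa using h ω

theorem integrable_card_freshHits {P : Measure Ω} [IsFiniteMeasure P] {k : Ω → ℕ}
    (hk : Measurable k) {A : Set E} (hA : MeasurableSet A) {y : Fin n → Ω → E}
    (hy : ∀ i, Measurable (y i)) :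
    Integrable (fun ω => ((freshHits (k ω) A (fun i => y i ω)).card : ℝ)) P := by
  simp only [card_freshHits_eq_sum k A y]
  exact integrable_finsetSum _ fun i _ =>
    (integrable_const 1).indicator ((hk measurableSet_Iic).inter (hy i hA))

/-- Position `i` is fresh exactly when `k ≤ i`, an event independent of `y i`, so it contributes
`P(k ≤ i) * p`. Summing the indicators of `k ≤ i` over `i` gives `n - k`. -/
theorem integral_card_freshHits {P : Measure Ω} [IsProbabilityMeasure P] {k : Ω → ℕ}
    (hk : Measurable k) (hkn : ∀ ω, k ω ≤ n) {A : Set E} (hA : MeasurableSet A)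
    {y : Fin n → Ω → E} (hy : ∀ i, Measurable (y i)) (hind : ∀ i, IndepFun k (y i) P)
    {p : ℝ} (hp : ∀ i, P.real (y i ⁻¹' A) = p) :
    ∫ ω, ((freshHits (k ω) A (fun i => y i ω)).card : ℝ) ∂P = (n - ∫ ω, (k ω : ℝ) ∂P) * p := by
  have hmeas : ∀ i : Fin n, MeasurableSet (k ⁻¹' Set.Iic (i : ℕ)) := fun i => hk measurableSet_Iic
  simp only [card_freshHits_eq_sum k A y]
  rw [integral_finsetSum _ fun i _ => (integrable_const 1).indicator ((hmeas i).inter (hy i hA))]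
  have h1 : ∀ i : Fin n,
      ∫ ω, (k ⁻¹' Set.Iic (i : ℕ) ∩ y i ⁻¹' A).indicator (fun _ => (1 : ℝ)) ω ∂P
        = (∫ ω, (k ⁻¹' Set.Iic (i : ℕ)).indicator (fun _ => (1 : ℝ)) ω ∂P) * p := by
    intro i
    rw [integral_indicator_const _ ((hmeas i).inter (hy i hA)),
      integral_indicator_const _ (hmeas i), ← hp i]
    simp only [smul_eq_mul, mul_one, Measure.real]
    rw [(hind i).measure_inter_preimage_eq_mul _ _ measurableSet_Iic hA, ENNReal.toReal_mul]
  rw [Finset.sum_congr rfl fun i _ => h1 i, ← Finset.sum_mul,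
    ← integral_finsetSum _ fun i _ => (integrable_const 1).indicator (hmeas i)]
  congr 1
  have h2 : ∀ ω, ∑ i : Fin n, (k ⁻¹' Set.Iic (i : ℕ)).indicator (fun _ => (1 : ℝ)) ω
      = n - (k ω : ℝ) := by
    intro ω
    rw [← sum_ite_le_eq_sub (hkn ω)]
    refine Finset.sum_congr rfl fun i _ => ?_
    by_cases h : k ω ≤ (i : ℕ) <;> simp [h]
  simp only [h2]
  rw [integral_sub (integrable_const _) (integrable_natCast_of_le hk hkn)]
  simp

variable [NormedAddCommGroup E] [BorelSpace E]

theorem measurable_pool (g : ℕ → ℝ) {X : ℕ → Fin n → Ω → E} (ℓ : ℕ)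
    (hX : ∀ j ≤ ℓ, ∀ i, Measurable (X j i)) (i : Fin n) :
    Measurable fun ω => pool g (fun j i => X j i ω) ℓ i := by
  induction ℓ generalizing i with
  | zero => exact hX 0 le_rfl i
  | succ ℓ ih =>
    exact measurable_reuse measurableSet_closedBall
      (fun i => ih (fun j hj => hX j (hj.trans ℓ.le_succ)) i) (hX _ le_rfl) i

theorem measurable_reusedCount (g : ℕ → ℝ) {X : ℕ → Fin n → Ω → E} (ℓ : ℕ)
    (hX : ∀ j < ℓ, ∀ i, Measurable (X j i)) :
    Measurable fun ω => reusedCount g (fun j i => X j i ω) ℓ := by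
  cases ℓ with
  | zero => exact measurable_const
  | succ ℓ =>
    exact measurable_card_reusable measurableSet_closedBall
      fun i => measurable_pool g ℓ (fun j hj => hX j (Nat.lt_succ_of_le hj)) i

theorem indepFun_reusedCount (g : ℕ → ℝ) {m : ℕ} {P : Measure Ω} {X : ℕ → Fin n → Ω → E}
    (hX : ∀ ℓ ≤ m, ∀ i, Measurable (X ℓ i))
    (hindep : iIndepFun (fun p : Fin (m + 1) × Fin n => X p.1 p.2) P) {ℓ : ℕ} (hℓ : ℓ ≤ m)
    (i : Fin n) : IndepFun (fun ω => reusedCount g (fun j i => X j i ω) ℓ) (X ℓ i) P := by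
  classical
  let p₀ : Fin (m + 1) × Fin n := (⟨ℓ, Nat.lt_succ_of_le hℓ⟩, i)
  let S : Finset (Fin (m + 1) × Fin n) := Finset.univ.filter fun p => (p.1 : ℕ) < ℓ
  have hdisj : Disjoint S {p₀} := by
    simp [S, p₀]
  have hI := hindep.indepFun_finset S {p₀} hdisj
    fun p => hX p.1 (Nat.le_of_lt_succ p.1.2) p.2
  -- Extend the finite block of levels below `ℓ` to a full array; the default `0` is never read by
  -- the reused count at level `ℓ`.
  let Z : ℕ → Fin n → (S → E) → E := fun j i t =>
    if h : j < ℓ then t ⟨(⟨j, h.trans (Nat.lt_succ_of_le hℓ)⟩, i), by simp [S, h]⟩ else 0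
  have hZ : ∀ j < ℓ, ∀ i, Measurable (Z j i) := by
    intro j hj i
    simp only [Z, hj, dif_pos]
    exact measurable_pi_apply _
  have hφ : Measurable fun t : S → E => reusedCount g (fun j i => Z j i t) ℓ :=
    measurable_reusedCount g ℓ hZ
  have hψ : Measurable fun t : ({p₀} : Finset (Fin (m + 1) × Fin n)) → E =>
      t ⟨p₀, Finset.mem_singleton_self _⟩ := measurable_pi_apply _
  have h := hI.comp hφ hψ
  have h1 : (fun ω => reusedCount g (fun j i => X j i ω) ℓ)
      = (fun t : S → E => reusedCount g (fun j i => Z j i t) ℓ) ∘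
        fun ω (p : S) => X p.1.1 p.1.2 ω := by
    funext ω
    refine reusedCount_congr g ℓ fun j hj => ?_
    funext i
    simp [Z, hj]
  rw [h1]
  exact h

end Measurability

/-! ### Uniform samples on balls -/

section Uniform

variable {Ω E : Type*} [MeasurableSpace Ω] [NormedAddCommGroup E] [MeasurableSpace E]
  [BorelSpace E]

theorem measureReal_preimage_closedBall {vol : Measure E} {d : ℕ} {c : ℝ} (hc : 0 < c)
    (hvol : ∀ r : ℝ, 0 < r → vol (Metric.closedBall (0 : E) r) = ENNReal.ofReal (c * r ^ d))
    {P : Measure Ω} {x : Ω → E} (hx : Measurable x) {r : ℝ} (hr : 0 < r)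
    (hunif : pdf.IsUniform x (Metric.closedBall 0 r) P vol) {ρ : ℝ} (hρ : 0 < ρ) :
    P.real (x ⁻¹' Metric.closedBall 0 ρ) = (min ρ r / r) ^ d := by
  have hmin : 0 < min ρ r := lt_min hρ hr
  have hinter : Metric.closedBall (0 : E) r ∩ Metric.closedBall 0 ρ
      = Metric.closedBall 0 (min ρ r) := by
    ext z
    simp [and_comm]
  rw [Measure.real, ← Measure.map_apply hx measurableSet_closedBall, hunif,
    ProbabilityTheory.cond_apply measurableSet_closedBall, hinter, hvol r hr, hvol _ hmin,
    ENNReal.toReal_mul, ENNReal.toReal_inv, ENNReal.toReal_ofReal (by positivity),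
    ENNReal.toReal_ofReal (by positivity)]
  rw [div_pow]
  field_simp

end Uniform

/-! ### Expected counts on the grid intervals -/

section Expectation

variable {Ω E : Type*} [MeasurableSpace Ω] [NormedAddCommGroup E] [MeasurableSpace E]
  [BorelSpace E] {vol : Measure E} {d : ℕ} {c : ℝ} {m N : ℕ} {g : ℕ → ℝ}
  {P : Measure Ω} [IsProbabilityMeasure P] {X : ℕ → Fin N → Ω → E}

theorem integrable_card_freshHits_reusedCount (hX : ∀ ℓ ≤ m, ∀ i, Measurable (X ℓ i)) {ℓ : ℕ}
    (hℓ : ℓ ≤ m) (ρ : ℝ) :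
    Integrable (fun ω => ((freshHits (reusedCount g (fun j i => X j i ω) ℓ)
      (Metric.closedBall 0 ρ) (fun i => X ℓ i ω)).card : ℝ)) P :=
  integrable_card_freshHits (measurable_reusedCount g ℓ fun j hj => hX j (hj.le.trans hℓ))
    measurableSet_closedBall (hX ℓ hℓ)

theorem integrable_originalCount (hX : ∀ ℓ ≤ m, ∀ i, Measurable (X ℓ i)) (ρ : ℝ) :
    Integrable (fun ω => (originalCount g m (fun ℓ i => X ℓ i ω) ρ : ℝ)) P := by
  simp only [originalCount_eq_sum, Nat.cast_sum]
  exact integrable_finsetSum _ fun ℓ hℓ => integrable_card_freshHits_reusedCount hX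
    (Nat.le_of_lt_succ (Finset.mem_range.1 hℓ)) ρ

theorem integral_originalCount (hX : ∀ ℓ ≤ m, ∀ i, Measurable (X ℓ i)) (ρ : ℝ) :
    ∫ ω, (originalCount g m (fun ℓ i => X ℓ i ω) ρ : ℝ) ∂P
      = ∑ ℓ ∈ Finset.range (m + 1), ∫ ω, ((freshHits (reusedCount g (fun j i => X j i ω) ℓ)
          (Metric.closedBall 0 ρ) (fun i => X ℓ i ω)).card : ℝ) ∂P := by
  simp only [originalCount_eq_sum, Nat.cast_sum]
  exact integral_finsetSum _ fun ℓ hℓ => integrable_card_freshHits_reusedCount hX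
    (Nat.le_of_lt_succ (Finset.mem_range.1 hℓ)) ρ

theorem integral_card_freshHits_reusedCount (hc : 0 < c)
    (hvol : ∀ r : ℝ, 0 < r → vol (Metric.closedBall (0 : E) r) = ENNReal.ofReal (c * r ^ d))
    (hg : ∀ ℓ ≤ m, 0 < g ℓ) (hX : ∀ ℓ ≤ m, ∀ i, Measurable (X ℓ i))
    (hunif : ∀ ℓ ≤ m, ∀ i, pdf.IsUniform (X ℓ i) (Metric.closedBall 0 (g ℓ)) P vol)
    (hindep : iIndepFun (fun p : Fin (m + 1) × Fin N => X p.1 p.2) P) {ℓ : ℕ} (hℓ : ℓ ≤ m)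
    {ρ : ℝ} (hρ : 0 < ρ) :
    ∫ ω, ((freshHits (reusedCount g (fun j i => X j i ω) ℓ)
      (Metric.closedBall 0 ρ) (fun i => X ℓ i ω)).card : ℝ) ∂P
      = (N - ∫ ω, (reusedCount g (fun j i => X j i ω) ℓ : ℝ) ∂P) * (min ρ (g ℓ) / g ℓ) ^ d :=
  integral_card_freshHits (measurable_reusedCount g ℓ fun j hj => hX j (hj.le.trans hℓ))
    (fun _ => reusedCount_le _ _ _) measurableSet_closedBall (hX ℓ hℓ)
    (indepFun_reusedCount g hX hindep hℓ)
    fun i => measureReal_preimage_closedBall hc hvol (hX ℓ hℓ i) (hg ℓ hℓ) (hunif ℓ hℓ i) hρ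

/-- Telescoping of `card_reusable_pool_succ`: the ball of radius `ρ ≤ g j` lies in every ball up to
level `j`, so none of these steps discards a point of it. -/
theorem integral_card_reusable_pool_eq_sum (hganti : StrictAntiOn g (Set.Iic m))
    (hX : ∀ ℓ ≤ m, ∀ i, Measurable (X ℓ i)) {j : ℕ} (hj : j ≤ m) {ρ : ℝ} (hρ : ρ ≤ g j) :
    ∫ ω, ((reusable (Metric.closedBall 0 ρ) (pool g (fun j i => X j i ω) j)).card : ℝ) ∂P
      = ∑ ℓ ∈ Finset.range (j + 1), ∫ ω, ((freshHits (reusedCount g (fun j i => X j i ω) ℓ)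
          (Metric.closedBall 0 ρ) (fun i => X ℓ i ω)).card : ℝ) ∂P := by
  induction j with
  | zero => simp [card_reusable_pool_zero]
  | succ j ih =>
    have hj' : j ≤ m := j.le_succ.trans hj
    rw [Finset.sum_range_succ, ← ih hj'
      (hρ.trans (hganti.antitoneOn (Set.mem_Iic.2 hj') (Set.mem_Iic.2 hj) j.le_succ)),
      ← integral_add _ (integrable_card_freshHits_reusedCount hX hj ρ)]
    · refine integral_congr_ae (ae_of_all _ fun ω => ?_)
      simp only
      rw [card_reusable_pool_succ g _ j (Metric.closedBall_subset_closedBall hρ), Nat.cast_add]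
    · exact integrable_natCast_of_le (measurable_card_reusable measurableSet_closedBall
        fun i => measurable_pool g j (fun l hl => hX l (hl.trans hj')) i)
        fun ω => card_reusable_le _ _

/-- The induction hypothesis is used at `ρ` for the retained points and at `g (j + 1)` for the mean
reused count. The `N - N (g (j + 1) / g j) ^ d` fresh samples expected then restore exactly the
missing mass, since `(g (j + 1) / g j) ^ d * (ρ / g (j + 1)) ^ d = (ρ / g j) ^ d`. -/
theorem integral_card_reusable_pool (hc : 0 < c)
    (hvol : ∀ r : ℝ, 0 < r → vol (Metric.closedBall (0 : E) r) = ENNReal.ofReal (c * r ^ d))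
    (hg : ∀ ℓ ≤ m, 0 < g ℓ) (hganti : StrictAntiOn g (Set.Iic m))
    (hX : ∀ ℓ ≤ m, ∀ i, Measurable (X ℓ i))
    (hunif : ∀ ℓ ≤ m, ∀ i, pdf.IsUniform (X ℓ i) (Metric.closedBall 0 (g ℓ)) P vol)
    (hindep : iIndepFun (fun p : Fin (m + 1) × Fin N => X p.1 p.2) P) {j : ℕ} (hj : j ≤ m)
    {ρ : ℝ} (hρ : 0 < ρ) (hρj : ρ ≤ g j) :
    ∫ ω, ((reusable (Metric.closedBall 0 ρ) (pool g (fun j i => X j i ω) j)).card : ℝ) ∂P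
      = N * (ρ / g j) ^ d := by
  induction j generalizing ρ with
  | zero =>
    rw [integral_card_reusable_pool_eq_sum hganti hX hj hρj, zero_add, Finset.sum_range_one,
      integral_card_freshHits_reusedCount hc hvol hg hX hunif hindep hj hρ, min_eq_left hρj]
    simp [reusedCount]
  | succ j ih =>
    have hj' : j ≤ m := j.le_succ.trans hj
    have hle : g (j + 1) ≤ g j :=
      hganti.antitoneOn (Set.mem_Iic.2 hj') (Set.mem_Iic.2 hj) j.le_succ
    have h0 := hg j hj'
    have h1 := hg (j + 1) hj
    rw [integral_card_reusable_pool_eq_sum hganti hX hj hρj, Finset.sum_range_succ,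
      ← integral_card_reusable_pool_eq_sum hganti hX hj' (hρj.trans hle),
      ih hj' hρ (hρj.trans hle),
      integral_card_freshHits_reusedCount hc hvol hg hX hunif hindep hj hρ, min_eq_left hρj]
    simp only [reusedCount]
    rw [ih hj' h1 hle]
    simp only [div_pow]
    field_simp
    ring

/-- On a grid interval the expected number of original samples grows like `N (ρ / g j) ^ d`. -/
theorem integral_originalCount_eq (hc : 0 < c)
    (hvol : ∀ r : ℝ, 0 < r → vol (Metric.closedBall (0 : E) r) = ENNReal.ofReal (c * r ^ d))
    (hg : ∀ ℓ ≤ m, 0 < g ℓ) (hganti : StrictAntiOn g (Set.Iic m))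
    (hX : ∀ ℓ ≤ m, ∀ i, Measurable (X ℓ i))
    (hunif : ∀ ℓ ≤ m, ∀ i, pdf.IsUniform (X ℓ i) (Metric.closedBall 0 (g ℓ)) P vol)
    (hindep : iIndepFun (fun p : Fin (m + 1) × Fin N => X p.1 p.2) P) {j : ℕ} (hj : j ≤ m) :
    ∃ C : ℝ, ∀ ρ, 0 < ρ → ρ ≤ g j → (j < m → g (j + 1) ≤ ρ) →
      ∫ ω, (originalCount g m (fun ℓ i => X ℓ i ω) ρ : ℝ) ∂P = N * (ρ / g j) ^ d + C := by
  -- The constant is the expected number of samples generated at levels beyond `j`.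
  refine ⟨∑ ℓ ∈ Finset.Ico (j + 1) (m + 1),
    (N - ∫ ω, (reusedCount g (fun j i => X j i ω) ℓ : ℝ) ∂P), fun ρ hρ hρj hjρ => ?_⟩
  rw [integral_originalCount hX, ← Finset.sum_range_add_sum_Ico _ (Nat.succ_le_succ hj),
    ← integral_card_reusable_pool_eq_sum hganti hX hj hρj,
    integral_card_reusable_pool hc hvol hg hganti hX hunif hindep hj hρ hρj]
  congr 1
  refine Finset.sum_congr rfl fun ℓ hℓ => ?_
  obtain ⟨h1, h2⟩ := Finset.mem_Ico.1 hℓ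
  have hℓm : ℓ ≤ m := Nat.le_of_lt_succ h2
  have hjm : j + 1 ≤ m := h1.trans hℓm
  -- Samples of such a level hit the ball of radius `ρ` with probability one.
  have hℓρ : g ℓ ≤ ρ := (hganti.antitoneOn (Set.mem_Iic.2 hjm) (Set.mem_Iic.2 hℓm) h1).trans
    (hjρ hjm)
  rw [integral_card_freshHits_reusedCount hc hvol hg hX hunif hindep hℓm hρ, min_eq_right hℓρ,
    div_self (hg ℓ hℓm).ne', one_pow, mul_one]

theorem integral_originalCount_of_ge (hc : 0 < c)
    (hvol : ∀ r : ℝ, 0 < r → vol (Metric.closedBall (0 : E) r) = ENNReal.ofReal (c * r ^ d))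
    (hg : ∀ ℓ ≤ m, 0 < g ℓ) (hganti : StrictAntiOn g (Set.Iic m))
    (hX : ∀ ℓ ≤ m, ∀ i, Measurable (X ℓ i))
    (hunif : ∀ ℓ ≤ m, ∀ i, pdf.IsUniform (X ℓ i) (Metric.closedBall 0 (g ℓ)) P vol)
    (hindep : iIndepFun (fun p : Fin (m + 1) × Fin N => X p.1 p.2) P)
    {ρ : ℝ} (hρ : g 0 ≤ ρ) :
    ∫ ω, (originalCount g m (fun ℓ i => X ℓ i ω) ρ : ℝ) ∂P
      = ∑ ℓ ∈ Finset.range (m + 1),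
        (N - ∫ ω, (reusedCount g (fun j i => X j i ω) ℓ : ℝ) ∂P) := by
  rw [integral_originalCount hX]
  refine Finset.sum_congr rfl fun ℓ hℓ => ?_
  have hℓm : ℓ ≤ m := Nat.le_of_lt_succ (Finset.mem_range.1 hℓ)
  have hℓρ : g ℓ ≤ ρ := (hganti.antitoneOn (Set.mem_Iic.2 m.zero_le) (Set.mem_Iic.2 hℓm)
    ℓ.zero_le).trans hρ
  rw [integral_card_freshHits_reusedCount hc hvol hg hX hunif hindep hℓm
    ((hg 0 m.zero_le).trans_le hρ), min_eq_right hℓρ, div_self (hg ℓ hℓm).ne', one_pow, mul_one]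

/-- The expected count need only agree with the differentiable `f` at `ρ` and along `l`; choosing
`l` one-sided handles the grid points, where the formula changes. -/
theorem tendsto_densityQuotient (hX : ∀ ℓ ≤ m, ∀ i, Measurable (X ℓ i)) {f : ℝ → ℝ} {D ρ : ℝ}
    (hf : HasDerivAt f D ρ) {l : Filter ℝ} (hl : l ≤ 𝓝[≠] 0)
    (hρ : ∫ ω, (originalCount g m (fun ℓ i => X ℓ i ω) ρ : ℝ) ∂P = f ρ)
    (hev : ∀ᶠ δ in l, ∫ ω, (originalCount g m (fun ℓ i => X ℓ i ω) (ρ + δ) : ℝ) ∂P = f (ρ + δ)) :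
    Tendsto (densityQuotient P g m X ρ) l (𝓝 D) := by
  refine ((hasDerivAt_iff_tendsto_slope_zero.1 hf).mono_left hl).congr' ?_
  filter_upwards [hev] with δ hδ
  rw [densityQuotient, integral_sub (integrable_originalCount hX _) (integrable_originalCount hX _),
    hδ, hρ, smul_eq_mul, div_eq_inv_mul]

end Expectation

theorem hasDerivAt_mul_div_pow_add_const (N r C : ℝ) {d : ℕ} (hd : 0 < d) {ρ : ℝ} (hρ : ρ ≠ 0) :
    HasDerivAt (fun ρ : ℝ => N * (ρ / r) ^ d + C) (N * d / ρ * (ρ / r) ^ d) ρ := by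
  have h := ((((hasDerivAt_id ρ).div_const r).pow d).const_mul N).add_const C
  refine h.congr_deriv ?_
  obtain ⟨e, rfl⟩ := Nat.exists_eq_succ_of_ne_zero hd.ne'
  simp only [id, Nat.succ_eq_add_one, Nat.add_sub_cancel, pow_succ]
  field_simp

end SampleReuse

/-! ### Differentiation of the expected count -/

theorem theorem5
    {E : Type*} [NormedAddCommGroup E] [NormedSpace ℝ E] [MeasurableSpace E] [BorelSpace E]
    (vol : Measure E) (d : ℕ) (hd : 0 < d) (c : ℝ) (hc : 0 < c)
    (hvol : ∀ r : ℝ, 0 < r → vol (Metric.closedBall (0 : E) r) = ENNReal.ofReal (c * r ^ d))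
    (a κ : ℝ) (ha : 0 < a) (hκ : 1 ≤ κ)
    (m : ℕ) (g : ℕ → ℝ) (hg : StrictAntiOn g (Set.Iic m)) (hg0 : g 0 = a) (hgm : g m = a / κ)
    (N : ℕ) (hN : 0 < N)
    {Ω : Type*} [MeasurableSpace Ω] (P : Measure Ω) [IsProbabilityMeasure P]
    (X : ℕ → Fin N → Ω → E)
    (hX : ∀ ℓ ≤ m, ∀ i, Measurable (X ℓ i))
    (hunif : ∀ ℓ ≤ m, ∀ i, pdf.IsUniform (X ℓ i) (Metric.closedBall 0 (g ℓ)) P vol)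
    (hindep : iIndepFun (fun p : Fin (m + 1) × Fin N => X p.1 p.2) P) :
    (∀ ρ : ℝ, Integrable
      (fun ω => (SampleReuse.originalCount g m (fun ℓ i => X ℓ i ω) ρ : ℝ)) P) ∧
    (∀ ρ : ℝ, 0 < ρ → ρ ≤ a / κ →
      Tendsto (SampleReuse.densityQuotient P g m X ρ) (𝓝[<] 0)
        (𝓝 (N * d / ρ * (κ * ρ / a) ^ d)) ∧
      (ρ < a / κ →
        Tendsto (SampleReuse.densityQuotient P g m X ρ) (𝓝[≠] 0)
          (𝓝 (N * d / ρ * (κ * ρ / a) ^ d)))) ∧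
    (∀ ρ : ℝ, a / κ < ρ → ρ ≤ a →
      ∃ D : ℝ, D < N * d / ρ ∧
        Tendsto (SampleReuse.densityQuotient P g m X ρ) (𝓝[>] 0) (𝓝 D) ∧
        (ρ ∉ g '' Set.Iic m →
          Tendsto (SampleReuse.densityQuotient P g m X ρ) (𝓝[≠] 0) (𝓝 D))) := by
  classical
  have hm : m ∈ Set.Iic m := Set.mem_Iic.2 le_rfl
  have hgpos : ∀ ℓ ≤ m, 0 < g ℓ := fun ℓ hℓ =>
    (hgm ▸ div_pos ha (one_pos.trans_le hκ) : 0 < g m).trans_le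
      (hg.antitoneOn (Set.mem_Iic.2 hℓ) hm hℓ)
  have hadd : ∀ ρ : ℝ, Tendsto (fun δ => ρ + δ) (𝓝 0) (𝓝 ρ) := fun ρ => by
    simpa using (continuous_const_add ρ).tendsto 0
  have hlt : (𝓝[<] (0 : ℝ)) ≤ 𝓝[≠] 0 := nhdsWithin_mono _ fun x hx => ne_of_lt hx
  have hgt : (𝓝[>] (0 : ℝ)) ≤ 𝓝[≠] 0 := nhdsWithin_mono _ fun x hx => ne_of_gt hx
  refine ⟨SampleReuse.integrable_originalCount hX, fun ρ hρ hρm => ?_, fun ρ hρm hρa => ?_⟩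
  · obtain ⟨C, hC⟩ := SampleReuse.integral_originalCount_eq hc hvol hgpos hg hX hunif hindep
      (le_refl m)
    have hD := SampleReuse.hasDerivAt_mul_div_pow_add_const N (g m) C hd hρ.ne'
    have hDeq : (N * d / ρ * (ρ / g m) ^ d : ℝ) = N * d / ρ * (κ * ρ / a) ^ d := by
      rw [hgm, div_div_eq_mul_div, mul_comm ρ κ]
    rw [hDeq] at hD
    -- With `j = m` there is no next grid point, so the formula holds on all of `(0, a / κ]`.
    have hval : ∀ r, 0 < r → r ≤ a / κ → _ := fun r h0 h1 =>
      hC r h0 (h1.trans_eq hgm.symm) fun h => absurd h (lt_irrefl m)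
    refine ⟨SampleReuse.tendsto_densityQuotient hX hD hlt (hval ρ hρ hρm) ?_, fun hρm' =>
      SampleReuse.tendsto_densityQuotient hX hD le_rfl (hval ρ hρ hρm) ?_⟩
    · filter_upwards [nhdsWithin_le_nhds ((hadd ρ).eventually_const_lt hρ), self_mem_nhdsWithin]
        with δ h1 h2
      exact hval _ h1 (by linarith [Set.mem_Iio.1 h2])
    · filter_upwards [nhdsWithin_le_nhds ((hadd ρ).eventually_const_lt hρ),
        nhdsWithin_le_nhds ((hadd ρ).eventually_lt_const hρm')] with δ h1 h2
      exact hval _ h1 h2.le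
  · have hρ : 0 < ρ := (div_pos ha (one_pos.trans_le hκ)).trans hρm
    have hNd : (0 : ℝ) < N * d / ρ := by positivity
    rcases hρa.eq_or_lt with rfl | hρa
    -- At the outer radius the right-hand quotients involve only radii `≥ g 0`, where the expected
    -- count is constant; hence the density is `0`.
    · have hval : ∀ r, g 0 ≤ r → _ := fun r hr =>
        SampleReuse.integral_originalCount_of_ge hc hvol hgpos hg hX hunif hindep hr
      refine ⟨0, hNd, SampleReuse.tendsto_densityQuotient hX
        (hasDerivAt_const ρ _) hgt (hval ρ hg0.le) ?_, fun h =>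
          absurd ⟨0, Set.mem_Iic.2 m.zero_le, hg0⟩ h⟩
      filter_upwards [self_mem_nhdsWithin] with δ h
      exact hval _ (by linarith [Set.mem_Ioi.1 h])
    -- The first grid index with `g ℓ ≤ ρ` is positive because `ρ < g 0`; its predecessor `j`
    -- satisfies `g (j + 1) ≤ ρ < g j`.
    · have hex : ∃ ℓ, g ℓ ≤ ρ := ⟨m, hgm.trans_le hρm.le⟩
      obtain ⟨j, hj⟩ : ∃ j, Nat.find hex = j + 1 := by
        refine Nat.exists_eq_succ_of_ne_zero fun h => ?_
        have := Nat.find_spec hex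
        rw [h, hg0] at this
        exact this.not_gt hρa
      have hjρ : g (j + 1) ≤ ρ := hj ▸ Nat.find_spec hex
      have hρj : ρ < g j := not_le.1 (Nat.find_min hex (hj ▸ j.lt_succ_self))
      have hjm : j + 1 ≤ m := hj ▸ Nat.find_min' hex (hgm.trans_le hρm.le)
      obtain ⟨C, hC⟩ := SampleReuse.integral_originalCount_eq hc hvol hgpos hg hX hunif hindep
        (j.le_succ.trans hjm)
      have hD := SampleReuse.hasDerivAt_mul_div_pow_add_const N (g j) C hd hρ.ne'
      have hval : ∀ r, g (j + 1) ≤ r → r ≤ g j → _ := fun r h0 h1 =>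
        hC r ((hgpos _ hjm).trans_le h0) h1 fun _ => h0
      refine ⟨_, ?_, SampleReuse.tendsto_densityQuotient hX hD hgt (hval ρ hjρ hρj.le) ?_,
        fun hne => SampleReuse.tendsto_densityQuotient hX hD le_rfl (hval ρ hjρ hρj.le) ?_⟩
      · refine mul_lt_of_lt_one_right hNd (pow_lt_one₀ ?_ ?_ hd.ne')
        · exact div_nonneg hρ.le (hρ.trans hρj).le
        · exact (div_lt_one (hρ.trans hρj)).2 hρj
      · filter_upwards [nhdsWithin_le_nhds ((hadd ρ).eventually_lt_const hρj),
          self_mem_nhdsWithin] with δ h1 h2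
        exact hval _ (by linarith [Set.mem_Ioi.1 h2]) h1.le
      -- Off the grid, `ρ` is interior to its interval, so the same formula holds on both sides.
      · have hjρ' : g (j + 1) < ρ :=
          lt_of_le_of_ne hjρ fun h => hne ⟨j + 1, Set.mem_Iic.2 hjm, h⟩
        filter_upwards [nhdsWithin_le_nhds ((hadd ρ).eventually_lt_const hρj),
          nhdsWithin_le_nhds ((hadd ρ).eventually_const_lt hjρ')] with δ h1 h2
        exact hval _ h2.le h1.le
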